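/- Theorem 2.1 (Approximation of the projection onto convex sets by reflections). Let $\mathcal{C} \subseteq \mathbb{R}^N$ be a compact convex set with $0 \in \operatorname{int}(\mathcal{C})$, and let $\mathcal{P}^{\mathcal{C}} : \mathbb{R}^N \to \mathcal{C}$ be the metric (nearest point) projection onto $\mathcal{C}$. An affine reflection of $\mathbb{R}^N$ is a map $u \mapsto u - 2((u-u_0)\cdot \xi)\,\xi$ with $u_0, \xi \in \mathbb{R}^N$, $|\xi| = 1$. Then there exists a sequence of locally Lipschitz maps $\mathcal{F}_m : \mathbb{R}^N \to \mathbb{R}^N$ such that: (i) Each $\mathcal{F}_m$ is piecewise equal to a composition of finitely many affine reflections, that is, $\mathbb{R}^N$ is the union of finitely many closed convex polyhedra on each of which $\mathcal{F}_m$ coincides with a composition of finitely many affine reflections (the empty composition being the identity). In particular, for a.e. $u \in \mathbb{R}^N$, $\mathcal{F}_m$ is differentiable at $u$ with $D\mathcal{F}_m(u) \in O(N,\mathbb{R})$. (ii) Each $\mathcal{F}_m$ equals the identity on $\mathcal{C}$, so that $\mathcal{F}_m(E) = E$ for all $E \subseteq \mathcal{C}$, and $$\mathcal{F}_m(m\,\mathcal{C})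 \subseteq \left(1 + \tfrac1m\right)\mathcal{C} \qquad \text{for all } m \ge 1.$$ (iii) As $m \to \infty$, $\mathcal{F}_m \to \mathcal{P}^{\mathcal{C}}$ locally uniformly on $\mathbb{R}^N$, and $\mathcal{F}_m \overset{*}{\rightharpoonup} \mathcal{P}^{\mathcal{C}}$ weakly* in $[W^{1,\infty}_{loc}(\mathbb{R}^N)]^N$, that is, all these maps belong to $[W^{1,\infty}_{loc}(\mathbb{R}^N)]^N$ and, for every compact $K \subseteq \mathbb{R}^N$ and every $h \in L^1(K)$, $\int_K h\,\mathcal{F}_m\,dx \to \int_K h\,\mathcal{P}^{\mathcal{C}}\,dx$ and $\int_K h\,D\mathcal{F}_m\,dx \to \int_K h\,D\mathcal{P}^{\mathcal{C}}\,dx$, with $D$ the weak gradient. -/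

import Mathlib

open MeasureTheory Filter Topology Set
open scoped Pointwise ENNReal ContDiff RealInnerProductSpace

namespace Folding

/-- `ℝ^N` with its Euclidean norm and inner product. -/
abbrev RN (N : ℕ) : Type := EuclideanSpace ℝ (Fin N)

/-- The affine reflection `u ↦ u - 2 ((u - u₀) · ξ) ξ` with respect to the hyperplane
`u₀ + (span ξ)ᗮ`; it is used for unit vectors `ξ`. -/
noncomputable def reflectionMap {N : ℕ} (ξ u₀ : RN N) : RN N → RN N :=
  fun u => u - (2 * ⟪u - u₀, ξ⟫) • ξ

/-- `R` is an affine reflection of `ℝ^N` with respect to some affine hyperplane. -/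
def IsAffineReflection {N : ℕ} (R : RN N → RN N) : Prop :=
  ∃ ξ u₀ : RN N, ‖ξ‖ = 1 ∧ R = reflectionMap ξ u₀

/-- `G` is a composition of finitely many successive affine reflections. -/
def IsReflectionComposition {N : ℕ} (G : RN N → RN N) : Prop :=
  ∃ L : List (RN N → RN N),
    (∀ R ∈ L, IsAffineReflection R) ∧ G = L.foldr (fun R H => R ∘ H) id

/-- A closed convex polyhedron: an intersection of finitely many closed half-spaces. -/
def IsPolyhedron {N : ℕ} (A : Set (RN N)) : Prop :=
  ∃ (k : ℕ) (ξ : Fin k → RN N) (b : Fin k → ℝ), A = {u | ∀ i, ⟪u, ξ i⟫ ≤ b i}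

/-- `F` is piecewise equal to compositions of finitely many affine reflections: `ℝ^N` is the union
of finitely many closed convex polyhedra, on each of which `F` is such a composition. -/
def IsPiecewiseReflectionComposition {N : ℕ} (F : RN N → RN N) : Prop :=
  ∃ (n : ℕ) (A : Fin n → Set (RN N)),
    (∀ i, IsPolyhedron (A i)) ∧ (⋃ i, A i) = univ ∧
      ∀ i, ∃ G : RN N → RN N, IsReflectionComposition G ∧ EqOn F G (A i)

open Classical in
/-- The metric projection of `u` onto `C`: a point of `C` at minimal distance from `u` (unique if
`C` is convex, existing if `C` is nonempty and compact; the junk value is `u` if there is none). -/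
noncomputable def metricProjection {N : ℕ} (C : Set (RN N)) (u : RN N) : RN N :=
  if h : ∃ p ∈ C, ∀ q ∈ C, dist u p ≤ dist u q then h.choose else u

theorem metricProjection_spec {N : ℕ} {C : Set (RN N)} (hC : IsCompact C) (hne : C.Nonempty)
    (u : RN N) :
    metricProjection C u ∈ C ∧ ∀ q ∈ C, dist u (metricProjection C u) ≤ dist u q := by
  have h : ∃ p ∈ C, ∀ q ∈ C, dist u p ≤ dist u q := by
    obtain ⟨p, hp, hd⟩ := hC.exists_infDist_eq_dist hne u
    exact ⟨p, hp, fun q hq => hd ▸ Metric.infDist_le_dist_of_mem hq⟩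
  rw [metricProjection, dif_pos h]
  exact h.choose_spec

/-- `Df` is a weak (distributional) gradient of the map `f` on all of `ℝ^N`. -/
structure IsWeakGradient {N : ℕ} (f : RN N → RN N) (Df : RN N → RN N →L[ℝ] RN N) : Prop where
  locallyIntegrable : LocallyIntegrable f volume
  locallyIntegrable_gradient : LocallyIntegrable Df volume
  integral_eq : ∀ φ : RN N → ℝ, ContDiff ℝ ∞ φ → HasCompactSupport φ → ∀ v : RN N,
    ∫ x, (fderiv ℝ φ x v) • f x = - ∫ x, φ x • Df x v

/-- `f` belongs to `[W^{1,∞}_loc(ℝ^N)]^N` and has the weak gradient `Df`. -/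
structure IsW1InftyLoc {N : ℕ} (f : RN N → RN N) (Df : RN N → RN N →L[ℝ] RN N) : Prop where
  isWeakGradient : IsWeakGradient f Df
  memLp : ∀ K : Set (RN N), IsCompact K → MemLp f ∞ (volume.restrict K)
  memLp_gradient : ∀ K : Set (RN N), IsCompact K → MemLp Df ∞ (volume.restrict K)

/-- Weak* convergence `f m ⇀* g` in `L^∞_loc(ℝ^N; V)`: on every compact set `K` the pairings with
all `h ∈ L^1(K)` converge. -/
def WeakStarTendstoLInftyLoc {N : ℕ} {V : Type} [NormedAddCommGroup V] [NormedSpace ℝ V]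
    (f : ℕ → RN N → V) (g : RN N → V) : Prop :=
  ∀ K : Set (RN N), IsCompact K → ∀ h : RN N → ℝ, IntegrableOn h K volume →
    Tendsto (fun m => ∫ x in K, h x • f m x) atTop (𝓝 (∫ x in K, h x • g x))

/-- Weak* convergence `f m ⇀* g` in `[W^{1,∞}_loc(ℝ^N)]^N`: all the maps lie in this space, and
the maps as well as their weak gradients converge weakly* in `L^∞_loc`. -/
def WeakStarTendstoW1InftyLoc {N : ℕ} (f : ℕ → RN N → RN N) (g : RN N → RN N) : Prop :=
  ∃ (Df : ℕ → RN N → RN N →L[ℝ] RN N) (Dg : RN N → RN N →L[ℝ] RN N),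
    (∀ m, IsW1InftyLoc (f m) (Df m)) ∧ IsW1InftyLoc g Dg ∧
      WeakStarTendstoLInftyLoc f g ∧ WeakStarTendstoLInftyLoc Df Dg

end Folding

namespace Folding

variable {N : ℕ}

/-! The approximants are compositions of foldings: reflect the half-space beyond a hyperplane
disjoint from `C`, fix the other half. Such maps are nonexpansive and fix `C`, so they never
increase the distance to `C`. The difficulty is to bring points close to `C` without displacing
their projections. If the hyperplane lies at height at least `t - δ` above `C` and the point within
`t` of `C`, then the residual of a folded point is almost normal to the hyperplane. The fold thus
nearly slides the point along its residual, which keeps the projection. The error is at most `κ`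
times the drop of the squared norm, with `κ` of order `√(δ/t)` (`isControlledFolding_fold`). These
bounds telescope, so however many folds are used, the total drift is at most `κ * ‖u‖ ^ 2`.
Compactness gives finitely many folds that strictly shrink the norm on an outer shell. Iterating
empties the shell, and repeating this shell by shell gives uniform approximation on balls. The
common Lipschitz bound then upgrades uniform convergence to weak* convergence of gradients. -/

/-! ### Metric projection onto a convex set -/

theorem metricProjection_eq_of_inner_le {C : Set (RN N)} (hC : IsCompact C) {u p : RN N}
    (hp : p ∈ C) (h : ∀ c ∈ C, ⟪u - p, c - p⟫ ≤ 0) : metricProjection C u = p := by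
  obtain ⟨hq, hmin⟩ := metricProjection_spec hC ⟨p, hp⟩ u
  set q := metricProjection C u
  have h1 := hmin p hp
  have h2 := h q hq
  rw [dist_eq_norm, dist_eq_norm] at h1
  have h3 : ‖u - q‖ ^ 2 = ‖u - p‖ ^ 2 - 2 * ⟪u - p, q - p⟫ + ‖q - p‖ ^ 2 := by
    rw [← norm_sub_sq_real]; congr 2; abel
  have h4 : ‖u - q‖ ^ 2 ≤ ‖u - p‖ ^ 2 := by gcongr
  have h5 : ‖q - p‖ ^ 2 ≤ 0 := by linarith
  have h6 : ‖q - p‖ = 0 := by nlinarith [norm_nonneg (q - p)]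
  exact sub_eq_zero.1 (norm_eq_zero.1 h6)

theorem inner_sub_metricProjection_le {C : Set (RN N)} (hC : IsCompact C) (hconv : Convex ℝ C)
    (u : RN N) {c : RN N} (hc : c ∈ C) :
    ⟪u - metricProjection C u, c - metricProjection C u⟫ ≤ 0 := by
  obtain ⟨hq, hmin⟩ := metricProjection_spec hC ⟨c, hc⟩ u
  refine (norm_eq_iInf_iff_real_inner_le_zero hconv hq).1 ?_ c hc
  have : Nonempty C := ⟨⟨c, hc⟩⟩
  refine le_antisymm (le_ciInf fun w => ?_) (ciInf_le ⟨0, ?_⟩ (⟨_, hq⟩ : C))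
  · simpa [dist_eq_norm] using hmin w w.2
  · rintro _ ⟨w, rfl⟩; exact norm_nonneg _

theorem norm_sub_metricProjection_le {C : Set (RN N)} (hC : IsCompact C) (u : RN N) {c : RN N}
    (hc : c ∈ C) : ‖u - metricProjection C u‖ ≤ ‖u - c‖ := by
  simpa [dist_eq_norm] using (metricProjection_spec hC ⟨c, hc⟩ u).2 c hc

theorem norm_metricProjection_sub_le {C : Set (RN N)} (hC : IsCompact C) (hne : C.Nonempty)
    (hconv : Convex ℝ C) (u v : RN N) :
    ‖metricProjection C u - metricProjection C v‖ ≤ ‖u - v‖ := by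
  have hp := (metricProjection_spec hC hne u).1
  have hq := (metricProjection_spec hC hne v).1
  have h1 := inner_sub_metricProjection_le hC hconv u hq
  have h2 := inner_sub_metricProjection_le hC hconv v hp
  set p := metricProjection C u
  set q := metricProjection C v
  have h3 : ‖p - q‖ ^ 2 ≤ ⟪u - v, p - q⟫ := by
    rw [← real_inner_self_eq_norm_sq]
    simp only [inner_sub_left, inner_sub_right] at *
    linarith
  have h4 := real_inner_le_norm (u - v) (p - q)
  by_contra! h
  nlinarith [norm_nonneg (u - v)]

theorem lipschitzWith_metricProjection {C : Set (RN N)} (hC : IsCompact C) (hne : C.Nonempty)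
    (hconv : Convex ℝ C) : LipschitzWith 1 (metricProjection C) :=
  LipschitzWith.of_dist_le_mul fun u v => by
    simpa [dist_eq_norm] using norm_metricProjection_sub_le hC hne hconv u v

/-! ### Folding along a hyperplane -/

/-- The folding of `ℝ^N` onto the half-space `{u | ⟪u, ξ⟫ ≤ b}`. -/
noncomputable def fold (ξ : RN N) (b : ℝ) (u : RN N) : RN N :=
  u - (2 * max (⟪u, ξ⟫ - b) 0) • ξ

theorem fold_of_le {ξ u : RN N} {b : ℝ} (h : ⟪u, ξ⟫ ≤ b) : fold ξ b u = u := by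
  simp [fold, max_eq_right (sub_nonpos.2 h)]

theorem fold_of_ge {ξ u : RN N} {b : ℝ} (h : b ≤ ⟪u, ξ⟫) :
    fold ξ b u = u - (2 * (⟪u, ξ⟫ - b)) • ξ := by
  simp [fold, max_eq_left (sub_nonneg.2 h)]

theorem norm_fold_sub_fold_le {ξ : RN N} (hξ : ‖ξ‖ = 1) (b : ℝ) (u v : RN N) :
    ‖fold ξ b u - fold ξ b v‖ ≤ ‖u - v‖ := by
  have hd : ⟪u - v, ξ⟫ = (⟪u, ξ⟫ - b) - (⟪v, ξ⟫ - b) := by rw [inner_sub_left]; ring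
  set x := ⟪u, ξ⟫ - b with hx
  set y := ⟪v, ξ⟫ - b with hy
  set e := max x 0 - max y 0 with he
  have h1 : fold ξ b u - fold ξ b v = (u - v) - (2 * e) • ξ := by
    simp only [fold, ← hx, ← hy, he, mul_sub, sub_smul]; abel
  have h2 : ‖(u - v) - (2 * e) • ξ‖ ^ 2 = ‖u - v‖ ^ 2 - 4 * (e * (x - y) - e ^ 2) := by
    rw [norm_sub_sq_real, real_inner_smul_right, hd, norm_smul, hξ, mul_one, Real.norm_eq_abs,
      sq_abs]; ring
  -- The positive part is monotone and 1-Lipschitz, so `e` lies between `0` and `x - y`.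
  have h3 : 0 ≤ e * (x - y) - e ^ 2 := by
    rw [he]
    rcases max_cases x 0 with ⟨h, h'⟩ | ⟨h, h'⟩ <;> rcases max_cases y 0 with ⟨k, k'⟩ | ⟨k, k'⟩ <;>
      rw [h, k] <;> nlinarith
  rw [h1]
  exact le_of_sq_le_sq (by linarith) (norm_nonneg _)

theorem norm_sq_fold {ξ u : RN N} (hξ : ‖ξ‖ = 1) {b : ℝ} (h : b ≤ ⟪u, ξ⟫) :
    ‖fold ξ b u‖ ^ 2 = ‖u‖ ^ 2 - 4 * (⟪u, ξ⟫ - b) * b := by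
  rw [fold_of_ge h, norm_sub_sq_real, real_inner_smul_right, norm_smul, hξ, mul_one,
    Real.norm_eq_abs, sq_abs]; ring

/-! ### Reflection compositions, polyhedra and piecewise maps -/

theorem exists_linearIsometryEquiv_of_isAffineReflection {R : RN N → RN N}
    (hR : IsAffineReflection R) :
    ∃ (A : RN N ≃ₗᵢ[ℝ] RN N) (v : RN N), ∀ u, R u = A u + v := by
  obtain ⟨ξ, u₀, hξ, rfl⟩ := hR
  refine ⟨((ℝ ∙ ξ)ᗮ).reflection, (2 * ⟪u₀, ξ⟫) • ξ, fun u => ?_⟩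
  rw [Submodule.reflection_orthogonal_apply, Submodule.reflection_singleton_apply, hξ,
    reflectionMap, inner_sub_left, real_inner_comm u ξ]
  simp only [RCLike.ofReal_real_eq_id, id, one_pow, div_one, mul_sub, sub_smul, mul_smul, two_smul]
  module

theorem IsReflectionComposition.exists_linearIsometryEquiv {G : RN N → RN N}
    (hG : IsReflectionComposition G) :
    ∃ (A : RN N ≃ₗᵢ[ℝ] RN N) (v : RN N), ∀ u, G u = A u + v := by
  obtain ⟨L, hL, rfl⟩ := hG
  induction L with
  | nil => exact ⟨LinearIsometryEquiv.refl ℝ _, 0, by simp⟩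
  | cons R L ih =>
    obtain ⟨A, v, h⟩ := ih fun S hS => hL S (List.mem_cons_of_mem _ hS)
    obtain ⟨B, w, h'⟩ := exists_linearIsometryEquiv_of_isAffineReflection
      (hL R List.mem_cons_self)
    refine ⟨A.trans B, B v + w, fun u => ?_⟩
    simp [h, h', add_assoc]

theorem IsReflectionComposition.comp {G H : RN N → RN N}
    (hG : IsReflectionComposition G) (hH : IsReflectionComposition H) :
    IsReflectionComposition (G ∘ H) := by
  obtain ⟨L, hL, rfl⟩ := hG
  obtain ⟨M, hM, rfl⟩ := hH
  refine ⟨L ++ M, fun R hR => (List.mem_append.1 hR).elim (hL R) (hM R), ?_⟩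
  clear hL
  induction L with
  | nil => rfl
  | cons R L ih => rw [List.foldr_cons, List.cons_append, List.foldr_cons, Function.comp_assoc, ih]

theorem isReflectionComposition_id : IsReflectionComposition (id : RN N → RN N) :=
  ⟨[], fun _ h => absurd h List.not_mem_nil, rfl⟩

theorem IsAffineReflection.isReflectionComposition {R : RN N → RN N} (hR : IsAffineReflection R) :
    IsReflectionComposition R :=
  ⟨[R], by simpa using hR, rfl⟩

theorem isPolyhedron_of_fintype {ι : Type*} [Fintype ι] (ξ : ι → RN N) (b : ι → ℝ) :
    IsPolyhedron {u | ∀ i, ⟪u, ξ i⟫ ≤ b i} := by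
  refine ⟨Fintype.card ι, ξ ∘ (Fintype.equivFin ι).symm, b ∘ (Fintype.equivFin ι).symm, ?_⟩
  ext u
  exact ((Fintype.equivFin ι).symm.forall_congr_right (q := fun i => ⟪u, ξ i⟫ ≤ b i)).symm

theorem isPolyhedron_univ : IsPolyhedron (univ : Set (RN N)) := by
  simpa using isPolyhedron_of_fintype (N := N) (ι := Empty) (fun _ => 0) (fun _ => 0)

theorem isPolyhedron_halfSpace (ξ : RN N) (b : ℝ) : IsPolyhedron {u | ⟪u, ξ⟫ ≤ b} := by
  simpa using isPolyhedron_of_fintype (ι := Unit) (fun _ => ξ) (fun _ => b)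

theorem IsPolyhedron.inter {A B : Set (RN N)} (hA : IsPolyhedron A) (hB : IsPolyhedron B) :
    IsPolyhedron (A ∩ B) := by
  obtain ⟨k, η, c, rfl⟩ := hA
  obtain ⟨l, θ, d, rfl⟩ := hB
  convert isPolyhedron_of_fintype (Sum.elim η θ) (Sum.elim c d) using 1
  ext u
  simp

theorem IsPolyhedron.preimage {A : Set (RN N)} (hA : IsPolyhedron A) {G : RN N → RN N}
    (hG : IsReflectionComposition G) : IsPolyhedron (G ⁻¹' A) := by
  obtain ⟨k, η, c, rfl⟩ := hA
  obtain ⟨B, v, hB⟩ := hG.exists_linearIsometryEquiv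
  refine ⟨k, fun i => B.symm (η i), fun i => c i - ⟪v, η i⟫, ?_⟩
  ext u
  have h : ∀ i, ⟪G u, η i⟫ = ⟪u, B.symm (η i)⟫ + ⟪v, η i⟫ := fun i => by
    rw [hB, inner_add_left, ← B.inner_map_map u, B.apply_symm_apply]
  simp only [mem_preimage, mem_ofPred_eq, h, le_sub_iff_add_le]

theorem IsPolyhedron.convex {A : Set (RN N)} (hA : IsPolyhedron A) : Convex ℝ A := by
  obtain ⟨k, η, c, rfl⟩ := hA
  rw [ofPred_forall]
  refine convex_iInter fun i => ?_
  simp_rw [fun u => real_inner_comm (η i) u]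
  exact convex_halfSpace_le (innerSL ℝ (η i)).toLinearMap.isLinear (c i)

theorem isPiecewiseReflectionComposition_of_fintype {ι : Type*} [Fintype ι] {F : RN N → RN N}
    (A : ι → Set (RN N)) (hA : ∀ i, IsPolyhedron (A i)) (hU : ⋃ i, A i = univ)
    (hF : ∀ i, ∃ G : RN N → RN N, IsReflectionComposition G ∧ EqOn F G (A i)) :
    IsPiecewiseReflectionComposition F := by
  refine ⟨Fintype.card ι, A ∘ (Fintype.equivFin ι).symm, fun i => hA _, ?_, fun i => hF _⟩
  rw [← hU]
  exact (Fintype.equivFin ι).symm.surjective.iUnion_comp A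

theorem isPiecewiseReflectionComposition_id :
    IsPiecewiseReflectionComposition (id : RN N → RN N) :=
  isPiecewiseReflectionComposition_of_fintype (fun _ : Unit => univ) (fun _ => isPolyhedron_univ)
    (iUnion_const _) fun _ => ⟨id, isReflectionComposition_id, fun _ _ => rfl⟩

theorem isPiecewiseReflectionComposition_fold {ξ : RN N} (hξ : ‖ξ‖ = 1) (b : ℝ) :
    IsPiecewiseReflectionComposition (fold ξ b) := by
  refine isPiecewiseReflectionComposition_of_fintype (ι := Bool)
    (fun i => if i then {u | ⟪u, ξ⟫ ≤ b} else {u | ⟪u, -ξ⟫ ≤ -b}) ?_ ?_ ?_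
  · rintro (_ | _)
    · simpa only [Bool.false_eq_true, if_false] using isPolyhedron_halfSpace (-ξ) (-b)
    · simpa only [if_true] using isPolyhedron_halfSpace ξ b
  · refine eq_univ_of_forall fun u => ?_
    rcases le_total ⟪u, ξ⟫ b with h | h
    · exact mem_iUnion.2 ⟨true, by simpa using h⟩
    · exact mem_iUnion.2 ⟨false, by simpa [inner_neg_right] using h⟩
  · rintro (_ | _)
    · refine ⟨_, IsAffineReflection.isReflectionComposition ⟨ξ, b • ξ, hξ, rfl⟩, fun u hu => ?_⟩
      have h : b ≤ ⟪u, ξ⟫ := by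
        simp only [inner_neg_right, Bool.false_eq_true, if_false, mem_ofPred_eq] at hu
        linarith
      simp only [fold_of_ge h, reflectionMap, inner_sub_left,
        real_inner_smul_left, real_inner_self_eq_norm_sq, hξ]
      norm_num
    · exact ⟨_, isReflectionComposition_id, fun u hu => fold_of_le (by simpa using hu)⟩

theorem IsPiecewiseReflectionComposition.comp {F G : RN N → RN N}
    (hF : IsPiecewiseReflectionComposition F) (hG : IsPiecewiseReflectionComposition G) :
    IsPiecewiseReflectionComposition (F ∘ G) := by
  obtain ⟨n, A, hA, hAU, hF⟩ := hF
  obtain ⟨m, B, hB, hBU, hG⟩ := hG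
  choose F' hF' hFF' using hF
  choose G' hG' hGG' using hG
  refine isPiecewiseReflectionComposition_of_fintype (ι := Fin n × Fin m)
    -- Pulling back along the affine `G' j` rather than `G` keeps the pieces polyhedral; the two
    -- maps agree on `B j`.
    (fun i => B i.2 ∩ G' i.2 ⁻¹' A i.1) (fun i => (hB _).inter ((hA _).preimage (hG' _))) ?_ ?_
  · refine eq_univ_of_forall fun u => ?_
    obtain ⟨j, hj⟩ := mem_iUnion.1 (hBU ▸ mem_univ u)
    obtain ⟨i, hi⟩ := mem_iUnion.1 (hAU ▸ mem_univ (G' j u))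
    exact mem_iUnion.2 ⟨(i, j), hj, hi⟩
  · rintro ⟨i, j⟩
    refine ⟨F' i ∘ G' j, (hF' i).comp (hG' j), ?_⟩
    rintro u ⟨hu, hu'⟩
    simp only [Function.comp_apply, hGG' j hu, hFF' i hu']

/-- Frontiers of convex sets are null, so almost every point is interior to a piece, where the map
is an affine isometry. -/
theorem IsPiecewiseReflectionComposition.ae_hasFDerivAt {F : RN N → RN N}
    (hF : IsPiecewiseReflectionComposition F) :
    ∀ᵐ u ∂(volume : Measure (RN N)), ∃ R : RN N ≃ₗᵢ[ℝ] RN N,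
      HasFDerivAt F (R.toContinuousLinearEquiv : RN N →L[ℝ] RN N) u := by
  obtain ⟨n, A, hA, hU, hG⟩ := hF
  have h0 : ∀ᵐ u ∂(volume : Measure (RN N)), ∀ i, u ∉ frontier (A i) :=
    ae_all_iff.2 fun i => measure_eq_zero_iff_ae_notMem.1 ((hA i).convex.addHaar_frontier _)
  filter_upwards [h0] with u hu
  obtain ⟨i, hi⟩ := mem_iUnion.1 (hU ▸ mem_univ u)
  have hint : u ∈ interior (A i) := by
    by_contra h
    exact hu i ⟨subset_closure hi, h⟩
  obtain ⟨G, hG, hFG⟩ := hG i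
  obtain ⟨B, v, hB⟩ := hG.exists_linearIsometryEquiv
  refine ⟨B, ?_⟩
  have h1 : HasFDerivAt (fun x => B x + v) (B.toContinuousLinearEquiv : RN N →L[ℝ] RN N) u :=
    (B.toContinuousLinearEquiv : RN N →L[ℝ] RN N).hasFDerivAt.add_const v
  refine h1.congr_of_eventuallyEq ?_
  filter_upwards [mem_interior_iff_mem_nhds.1 hint] with x hx
  rw [hFG hx, hB]

/-! ### Foldings with controlled drift -/

/-- The distance of `u` to `C`, as the length of the residual of the metric projection. -/
noncomputable def residual (C : Set (RN N)) (u : RN N) : ℝ := ‖u - metricProjection C u‖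

/-- `T` is a nonexpansive piecewise composition of reflections which fixes `C` pointwise and which
moves the projections of the points at distance at most `s` from `C` by at most `κ` times the
decrease of the squared norm. -/
structure IsControlledFolding (C : Set (RN N)) (s κ : ℝ) (T : RN N → RN N) : Prop where
  piecewise : IsPiecewiseReflectionComposition T
  norm_sub_le : ∀ u v, ‖T u - T v‖ ≤ ‖u - v‖
  map_eq : ∀ c ∈ C, T c = c
  drift : ∀ u, residual C u ≤ s →
    ‖metricProjection C (T u) - metricProjection C u‖ ≤ κ * (‖u‖ ^ 2 - ‖T u‖ ^ 2)

theorem continuous_residual {C : Set (RN N)} (hC : IsCompact C) (hne : C.Nonempty)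
    (hconv : Convex ℝ C) : Continuous (residual C) :=
  (continuous_id.sub (lipschitzWith_metricProjection hC hne hconv).continuous).norm

theorem isCompact_residual_le {C : Set (RN N)} (hC : IsCompact C) (hne : C.Nonempty)
    (hconv : Convex ℝ C) (s : ℝ) : IsCompact {u | residual C u ≤ s} := by
  obtain ⟨R, hR⟩ := hC.isBounded.exists_norm_le
  refine Metric.isCompact_of_isClosed_isBounded
    (isClosed_le (continuous_residual hC hne hconv) continuous_const)
    (isBounded_iff_forall_norm_le.2 ⟨s + R, fun u hu => ?_⟩)
  have h1 := hR _ (metricProjection_spec hC hne u).1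
  have h2 : ‖u‖ ≤ ‖u - metricProjection C u‖ + ‖metricProjection C u‖ := by
    simpa using norm_add_le (u - metricProjection C u) (metricProjection C u)
  have h3 : ‖u - metricProjection C u‖ ≤ s := hu
  linarith

theorem isControlledFolding_id (C : Set (RN N)) (s κ : ℝ) : IsControlledFolding C s κ id :=
  ⟨isPiecewiseReflectionComposition_id, fun _ _ => le_rfl, fun _ _ => rfl, by simp⟩

namespace IsControlledFolding

variable {C : Set (RN N)} {s s' κ : ℝ} {S T : RN N → RN N}

theorem continuous (hT : IsControlledFolding C s κ T) : Continuous T :=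
  (LipschitzWith.of_dist_le_mul (K := 1) fun u v => by
    simpa [dist_eq_norm] using hT.norm_sub_le u v).continuous

theorem norm_le (hT : IsControlledFolding C s κ T) (h0 : (0 : RN N) ∈ C) (u : RN N) :
    ‖T u‖ ≤ ‖u‖ := by
  simpa [hT.map_eq 0 h0] using hT.norm_sub_le u 0

theorem residual_le (hT : IsControlledFolding C s κ T) (hC : IsCompact C) (hne : C.Nonempty)
    (u : RN N) : residual C (T u) ≤ residual C u := by
  have hp := (metricProjection_spec hC hne u).1
  calc residual C (T u) ≤ ‖T u - metricProjection C u‖ := norm_sub_metricProjection_le hC _ hp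
    _ = ‖T u - T (metricProjection C u)‖ := by rw [hT.map_eq _ hp]
    _ ≤ residual C u := hT.norm_sub_le _ _

/-- The drift bounds telescope, so `κ` does not grow with the number of folds. -/
theorem comp (hS : IsControlledFolding C s' κ S) (hT : IsControlledFolding C s κ T)
    (h : ∀ u, residual C u ≤ s → residual C (T u) ≤ s') : IsControlledFolding C s κ (S ∘ T) where
  piecewise := hS.piecewise.comp hT.piecewise
  norm_sub_le u v := (hS.norm_sub_le _ _).trans (hT.norm_sub_le u v)
  map_eq c hc := by simp only [Function.comp_apply, hT.map_eq c hc, hS.map_eq c hc]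
  drift u hu := by
    have h1 := hT.drift u hu
    have h2 := hS.drift (T u) (h u hu)
    have h3 := norm_add_le (metricProjection C (S (T u)) - metricProjection C (T u))
      (metricProjection C (T u) - metricProjection C u)
    rw [sub_add_sub_cancel] at h3
    simp only [Function.comp_apply]
    linarith

end IsControlledFolding

/-- With `w = u - p` and `a` the excess of `u` over the hyperplane, `a + (t - δ) ≤ ⟪w, ξ⟫ ≤ ‖w‖ ≤
t`. Hence `w` is almost parallel to `ξ`. Moving `u` by `2 * a` along `-w` keeps the projection `p`,
and the fold differs from this move by at most `2 * a * √(2 * δ / t)`. The squared norm drops by `4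
* a * b`, where `b ≥ r` because `C` contains the ball of radius `r`. -/
theorem isControlledFolding_fold {C : Set (RN N)} (hC : IsCompact C) (hconv : Convex ℝ C)
    {r : ℝ} (hr : 0 < r) (hball : Metric.closedBall 0 r ⊆ C) {t δ b : ℝ} {ξ : RN N}
    (hδ : 0 ≤ δ) (hδt : 2 * δ ≤ t) (ht : 0 < t) (hξ : ‖ξ‖ = 1)
    (hb : ∀ c ∈ C, ⟪c, ξ⟫ + (t - δ) ≤ b) :
    IsControlledFolding C t (√(2 * δ / t) / (2 * r)) (fold ξ b) where
  piecewise := isPiecewiseReflectionComposition_fold hξ b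
  norm_sub_le := norm_fold_sub_fold_le hξ b
  map_eq c hc := fold_of_le (by linarith [hb c hc])
  drift u hu := by
    have h0C : (0 : RN N) ∈ C := hball (by simp [hr.le])
    rcases le_total ⟪u, ξ⟫ b with hub | hub
    · simp [fold_of_le hub]
    rw [norm_sq_fold hξ hub]
    have hrb : r ≤ b := by
      have h1 := hb (r • ξ) (hball (by simp [norm_smul, hξ, abs_of_pos hr]))
      rw [real_inner_smul_left, real_inner_self_eq_norm_sq, hξ] at h1
      linarith
    obtain ⟨hp, -⟩ := metricProjection_spec hC ⟨0, h0C⟩ u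
    have hpu := fun c (hc : c ∈ C) => inner_sub_metricProjection_le hC hconv u hc
    have hs : ‖u - metricProjection C u‖ ≤ t := hu
    set p := metricProjection C u with hp_def
    set w := u - p with hw
    set a := ⟪u, ξ⟫ - b with ha
    have ha0 : 0 ≤ a := sub_nonneg.2 hub
    have hwξ : a + (t - δ) ≤ ⟪w, ξ⟫ := by
      rw [hw, inner_sub_left]; linarith [hb p hp]
    have hws : ⟪w, ξ⟫ ≤ ‖w‖ := by simpa [hξ] using real_inner_le_norm w ξ
    have hs0 : 0 < ‖w‖ := by linarith
    have haδ : 2 * a ≤ ‖w‖ := by linarith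
    -- As `2 * a ≤ ‖w‖`, the moved point stays on the segment from `u` to `p`.
    have hproj : metricProjection C (u - (2 * a / ‖w‖) • w) = p := by
      refine metricProjection_eq_of_inner_le hC hp fun c hc => ?_
      have h1 : u - (2 * a / ‖w‖) • w - p = (1 - 2 * a / ‖w‖) • w := by
        rw [sub_smul, one_smul, hw]; abel
      rw [h1, real_inner_smul_left]
      exact mul_nonpos_of_nonneg_of_nonpos (sub_nonneg.2 (div_le_one_of_le₀ haδ hs0.le)) (hpu c hc)
    have hangle : ‖(1 / ‖w‖) • w - ξ‖ ≤ √(2 * δ / t) := by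
      refine Real.le_sqrt_of_sq_le ?_
      rw [norm_sub_sq_real, real_inner_smul_left, norm_smul, hξ, Real.norm_eq_abs,
        abs_of_pos (by positivity), one_div_mul_cancel hs0.ne']
      have h1 : (t - δ) / t ≤ 1 / ‖w‖ * ⟪w, ξ⟫ := by
        rw [one_div_mul_eq_div, div_le_div_iff₀ ht hs0]
        nlinarith
      have h2 : (t - δ) / t = 1 - δ / t := by rw [sub_div, div_self ht.ne']
      have h3 : 2 * δ / t = 2 * (δ / t) := by ring
      linarith
    have hmove : fold ξ b u - (u - (2 * a / ‖w‖) • w) = (2 * a) • ((1 / ‖w‖) • w - ξ) := by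
      rw [fold_of_ge hub, ← ha, smul_sub (2 * a), smul_smul, mul_one_div]; abel
    have hdrift : ‖metricProjection C (fold ξ b u) - p‖ ≤ 2 * a * √(2 * δ / t) := by
      have h1 := norm_metricProjection_sub_le hC ⟨0, h0C⟩ hconv (fold ξ b u)
        (u - (2 * a / ‖w‖) • w)
      rw [hproj, hmove, norm_smul, Real.norm_eq_abs, abs_of_nonneg (by positivity)] at h1
      exact h1.trans (by gcongr)
    refine hdrift.trans ?_
    have h1 : √(2 * δ / t) / (2 * r) * (‖u‖ ^ 2 - (‖u‖ ^ 2 - 4 * a * b))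
        = 2 * a * √(2 * δ / t) * (b / r) := by field_simp; ring
    rw [h1]
    exact le_mul_of_one_le_right (by positivity) ((one_le_div hr).2 hrb)

theorem exists_isControlledFolding_norm_lt {C : Set (RN N)} (hC : IsCompact C) (hconv : Convex ℝ C)
    {r : ℝ} (hr : 0 < r) (hball : Metric.closedBall 0 r ⊆ C) {t δ : ℝ}
    (hδ : 0 < δ) (hδt : 2 * δ ≤ t) :
    ∃ T, IsControlledFolding C t (√(2 * δ / t) / (2 * r)) T ∧
      ∀ u, residual C u ≤ t → t - δ / 2 ≤ residual C u → ‖T u‖ < ‖u‖ := by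
  have h0C : (0 : RN N) ∈ C := hball (by simp [hr.le])
  have hne : C.Nonempty := ⟨0, h0C⟩
  have hK : IsCompact ({u | residual C u ≤ t} ∩ {u | t - δ / 2 ≤ residual C u}) :=
    (isCompact_residual_le hC hne hconv t).inter_right
      (isClosed_le continuous_const (continuous_residual hC hne hconv))
  -- The alternative `T u = u` is carried along for compositions: a point that the first map does
  -- not shrink reaches the second map unmoved.
  suffices h : ∃ T, IsControlledFolding C t (√(2 * δ / t) / (2 * r)) T ∧
      (∀ u, T u = u ∨ ‖T u‖ < ‖u‖) ∧
      ∀ u ∈ {u | residual C u ≤ t} ∩ {u | t - δ / 2 ≤ residual C u}, ‖T u‖ < ‖u‖ by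
    obtain ⟨T, hT, -, h⟩ := h
    exact ⟨T, hT, fun u hu hu' => h u ⟨hu, hu'⟩⟩
  refine hK.induction_on (p := fun K => ∃ T, IsControlledFolding C t (√(2 * δ / t) / (2 * r)) T ∧
      (∀ u, T u = u ∨ ‖T u‖ < ‖u‖) ∧ ∀ u ∈ K, ‖T u‖ < ‖u‖) ?_ ?_ ?_ ?_
  · exact ⟨id, isControlledFolding_id _ _ _, fun _ => Or.inl rfl, by simp⟩
  · rintro K L hKL ⟨T, hT, h, h'⟩
    exact ⟨T, hT, h, fun u hu => h' u (hKL hu)⟩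
  · rintro K L ⟨T, hT, h, h'⟩ ⟨S, hS, g, g'⟩
    refine ⟨S ∘ T, hS.comp hT fun u hu => (hT.residual_le hC hne u).trans hu, fun u => ?_, ?_⟩
    · rcases h u with hu | hu
      · simpa [hu] using g u
      · exact Or.inr ((hS.norm_le h0C _).trans_lt hu)
    · rintro u (hu | hu)
      · exact (hS.norm_le h0C _).trans_lt (h' u hu)
      · rcases h u with hv | hv
        · simpa [hv] using g' u hu
        · exact (hS.norm_le h0C _).trans_lt hv
  · rintro u ⟨hu, hu'⟩
    have hpu := fun c (hc : c ∈ C) => inner_sub_metricProjection_le hC hconv u hc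
    simp only [residual, mem_ofPred_eq] at hu hu'
    set p := metricProjection C u with hp
    have hs0 : 0 < ‖u - p‖ := by linarith
    -- The hyperplane is normal to the residual of `u`, at height `t - δ` above the supporting
    -- hyperplane at `p`. It cuts `u` off strictly, since the residual is at least `t - δ / 2`.
    set ξ := (1 / ‖u - p‖) • (u - p) with hξ_def
    have hξ : ‖ξ‖ = 1 := by
      rw [hξ_def, norm_smul, Real.norm_eq_abs, abs_of_pos (by positivity),
        one_div_mul_cancel hs0.ne']
    set b := ⟪p, ξ⟫ + (t - δ) with hb_def
    have hb : ∀ c ∈ C, ⟪c, ξ⟫ + (t - δ) ≤ b := fun c hc => by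
      have h1 : ⟪c - p, ξ⟫ ≤ 0 := by
        rw [hξ_def, real_inner_smul_right, real_inner_comm]
        exact mul_nonpos_of_nonneg_of_nonpos (by positivity) (hpu c hc)
      rw [inner_sub_left] at h1
      linarith
    have hb0 : 0 < b := by
      have h1 := hb 0 h0C
      rw [inner_zero_left] at h1
      linarith
    have hub : b < ⟪u, ξ⟫ := by
      have h1 : ⟪u - p, ξ⟫ = ‖u - p‖ := by
        rw [hξ_def, real_inner_smul_right, real_inner_self_eq_norm_sq]
        field_simp
      rw [inner_sub_left] at h1
      linarith
    have hlt : ∀ v, b < ⟪v, ξ⟫ → ‖fold ξ b v‖ < ‖v‖ := fun v hv => by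
      refine lt_of_pow_lt_pow_left₀ 2 (norm_nonneg _) ?_
      rw [norm_sq_fold hξ hv.le]
      have := mul_pos (sub_pos.2 hv) hb0
      linarith
    have hopen : IsOpen {v : RN N | b < ⟪v, ξ⟫} :=
      isOpen_lt continuous_const (continuous_id.inner continuous_const)
    refine ⟨_, mem_nhdsWithin_of_mem_nhds (hopen.mem_nhds hub), fold ξ b,
      isControlledFolding_fold hC hconv hr hball hδ.le hδt (by linarith) hξ hb, fun v => ?_, hlt⟩
    rcases le_or_gt ⟪v, ξ⟫ b with hv | hv
    · exact Or.inl (fold_of_le hv)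
    · exact Or.inr (hlt v hv)

/-- By compactness the norm drops by a uniform `γ` on the shell. As norms are nonnegative and
bounded on the neighbourhood, enough iterations drive every point out of the shell, and residuals
never increase again. -/
theorem exists_isControlledFolding_residual_le {C : Set (RN N)} (hC : IsCompact C)
    (hconv : Convex ℝ C) {r : ℝ} (hr : 0 < r) (hball : Metric.closedBall 0 r ⊆ C) {t δ : ℝ}
    (hδ : 0 < δ) (hδt : 2 * δ ≤ t) :
    ∃ T, IsControlledFolding C t (√(2 * δ / t) / (2 * r)) T ∧
      ∀ u, residual C u ≤ t → residual C (T u) ≤ t - δ / 2 := by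
  obtain ⟨T, hT, hlt⟩ := exists_isControlledFolding_norm_lt hC hconv hr hball hδ hδt
  have h0C : (0 : RN N) ∈ C := hball (by simp [hr.le])
  have hne : C.Nonempty := ⟨0, h0C⟩
  have hCt := isCompact_residual_le hC hne hconv t
  have hK : IsCompact ({u | residual C u ≤ t} ∩ {u | t - δ / 2 ≤ residual C u}) :=
    hCt.inter_right (isClosed_le continuous_const (continuous_residual hC hne hconv))
  obtain ⟨γ, hγ, hdec⟩ : ∃ γ > 0, ∀ u, residual C u ≤ t → t - δ / 2 ≤ residual C u →
      ‖T u‖ ≤ ‖u‖ - γ := by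
    obtain hemp | hKne := eq_empty_or_nonempty
      ({u | residual C u ≤ t} ∩ {u | t - δ / 2 ≤ residual C u})
    · exact ⟨1, one_pos, fun u hu hu' => absurd (hemp ▸ (⟨hu, hu'⟩ :
        u ∈ {u | residual C u ≤ t} ∩ {u | t - δ / 2 ≤ residual C u})) (notMem_empty u)⟩
    · obtain ⟨v, hv, hmin⟩ := hK.exists_isMinOn hKne
        (continuous_norm.sub hT.continuous.norm).continuousOn
      refine ⟨‖v‖ - ‖T v‖, sub_pos.2 (hlt v hv.1 hv.2), fun u hu hu' => ?_⟩
      have h1 : ‖v‖ - ‖T v‖ ≤ ‖u‖ - ‖T u‖ := hmin ⟨hu, hu'⟩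
      linarith
  have hiter : ∀ k : ℕ, ∃ S, IsControlledFolding C t (√(2 * δ / t) / (2 * r)) S ∧
      ∀ u, residual C u ≤ t → residual C (S u) ≤ t - δ / 2 ∨ ‖S u‖ ≤ ‖u‖ - k * γ := by
    intro k
    induction k with
    | zero => exact ⟨id, isControlledFolding_id _ _ _, by simp⟩
    | succ k ih =>
      obtain ⟨S, hS, h⟩ := ih
      have hSt : ∀ u, residual C u ≤ t → residual C (S u) ≤ t :=
        fun u hu => (hS.residual_le hC hne u).trans hu
      refine ⟨T ∘ S, hT.comp hS hSt, fun u hu => ?_⟩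
      rcases le_total (residual C (S u)) (t - δ / 2) with h1 | h1
      · exact Or.inl ((hT.residual_le hC hne _).trans h1)
      · rcases h u hu with h2 | h2
        · exact Or.inl ((hT.residual_le hC hne _).trans h2)
        · refine Or.inr ?_
          have h3 := hdec (S u) (hSt u hu) h1
          simp only [Function.comp_apply]
          push_cast
          linarith
  obtain ⟨R, hR⟩ := hCt.isBounded.exists_norm_le
  obtain ⟨k, hk⟩ := exists_nat_gt (R / γ)
  obtain ⟨S, hS, h⟩ := hiter k
  refine ⟨S, hS, fun u hu => (h u hu).resolve_right fun h1 => ?_⟩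
  rw [div_lt_iff₀ hγ] at hk
  linarith [hR u hu, norm_nonneg (S u)]

theorem IsControlledFolding.mono {C : Set (RN N)} {s κ κ' : ℝ} {T : RN N → RN N}
    (hT : IsControlledFolding C s κ T) (h0 : (0 : RN N) ∈ C) (hκ : κ ≤ κ') :
    IsControlledFolding C s κ' T where
  piecewise := hT.piecewise
  norm_sub_le := hT.norm_sub_le
  map_eq := hT.map_eq
  drift u hu := (hT.drift u hu).trans (mul_le_mul_of_nonneg_right hκ
    (sub_nonneg.2 (by gcongr; exact hT.norm_le h0 u)))

theorem exists_isControlledFolding_residual_le_of_pos {C : Set (RN N)} (hC : IsCompact C)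
    (hconv : Convex ℝ C) (h0 : (0 : RN N) ∈ interior C) {t η κ : ℝ} (hη : 0 < η) (hκ : 0 < κ) :
    ∃ T, IsControlledFolding C t κ T ∧ ∀ u, residual C u ≤ t → residual C (T u) ≤ η := by
  obtain ⟨r, hr, hball⟩ := Metric.nhds_basis_closedBall.mem_iff.1 (mem_interior_iff_mem_nhds.1 h0)
  have h0C : (0 : RN N) ∈ C := interior_subset h0
  -- One `δ` serves all stages: at every thickness `s ≥ η`, the drift constant is at most its value
  -- at `η`.
  obtain ⟨δ, hδ, hδη, hδκ⟩ : ∃ δ > 0, 2 * δ ≤ η ∧ √(2 * δ / η) / (2 * r) ≤ κ := by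
    refine ⟨min (η / 2) (η * (2 * r * κ) ^ 2 / 2), by positivity,
      by linarith [min_le_left (η / 2) (η * (2 * r * κ) ^ 2 / 2)], ?_⟩
    rw [div_le_iff₀ (by positivity), Real.sqrt_le_left (by positivity), div_le_iff₀ hη]
    linarith [min_le_right (η / 2) (η * (2 * r * κ) ^ 2 / 2)]
  have hiter : ∀ k : ℕ, ∃ T, IsControlledFolding C t κ T ∧
      ∀ u, residual C u ≤ t → residual C (T u) ≤ max η (t - k * (δ / 2)) := by
    intro k
    induction k with
    | zero => exact ⟨id, isControlledFolding_id _ _ _, fun u hu => le_max_of_le_right (by simpa)⟩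
    | succ k ih =>
      obtain ⟨T, hT, h⟩ := ih
      set s := max η (t - k * (δ / 2)) with hs
      have hηs : η ≤ s := le_max_left _ _
      obtain ⟨S, hS, h'⟩ := exists_isControlledFolding_residual_le hC hconv hr hball hδ
        (hδη.trans hηs)
      have hSκ := hS.mono h0C (κ' := κ) (le_trans (by gcongr) hδκ)
      refine ⟨S ∘ T, hSκ.comp hT h, fun u hu => (h' _ (h u hu)).trans ?_⟩
      push_cast
      rcases max_cases η (t - k * (δ / 2)) with ⟨h1, h2⟩ | ⟨h1, h2⟩
      · exact le_max_of_le_left (by linarith)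
      · exact le_max_of_le_right (by linarith)
  obtain ⟨k, hk⟩ := exists_nat_gt (t / (δ / 2))
  rw [div_lt_iff₀ (by positivity)] at hk
  obtain ⟨T, hT, h⟩ := hiter k
  exact ⟨T, hT, fun u hu => (h u hu).trans (max_le le_rfl (by linarith))⟩

theorem exists_piecewise_approx_metricProjection {C : Set (RN N)} (hC : IsCompact C)
    (hconv : Convex ℝ C) (h0 : (0 : RN N) ∈ interior C) (R : ℝ) {ε : ℝ} (hε : 0 < ε) :
    ∃ T : RN N → RN N, IsPiecewiseReflectionComposition T ∧ LipschitzWith 1 T ∧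
      (∀ c ∈ C, T c = c) ∧ ∀ u, ‖u‖ ≤ R → ‖T u - metricProjection C u‖ ≤ ε := by
  have h0C : (0 : RN N) ∈ C := interior_subset h0
  -- On the ball of radius `R` the squared norm drops by at most `R ^ 2`, so the drift costs at most
  -- `ε / 2`; the final residual costs the other half.
  obtain ⟨T, hT, h⟩ := exists_isControlledFolding_residual_le_of_pos hC hconv h0 (t := R)
    (η := ε / 2) (κ := ε / 2 / (R ^ 2 + 1)) (by positivity) (by positivity)
  refine ⟨T, hT.piecewise, LipschitzWith.of_dist_le_mul fun u v => by
    simpa [dist_eq_norm] using hT.norm_sub_le u v, hT.map_eq, fun u hu => ?_⟩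
  have hres : residual C u ≤ R := by
    have h1 := norm_sub_metricProjection_le hC u h0C
    rw [sub_zero] at h1
    exact h1.trans hu
  have h1 := hT.drift u hres
  have h2 : ‖T u - metricProjection C (T u)‖ ≤ ε / 2 := h u hres
  have h3 : ‖u‖ ^ 2 - ‖T u‖ ^ 2 ≤ R ^ 2 + 1 := by
    have : ‖u‖ ^ 2 ≤ R ^ 2 := by gcongr
    linarith [sq_nonneg ‖T u‖]
  have h4 : ε / 2 / (R ^ 2 + 1) * (‖u‖ ^ 2 - ‖T u‖ ^ 2) ≤ ε / 2 := by
    rw [div_mul_eq_mul_div, div_le_iff₀ (by positivity)]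
    gcongr
  have h5 := norm_add_le (T u - metricProjection C (T u))
    (metricProjection C (T u) - metricProjection C u)
  rw [sub_add_sub_cancel] at h5
  linarith

/-! ### Weak gradients and weak* convergence of Lipschitz maps -/

theorem tendsto_continuousLinearMap_of_forall_apply {α : Type*} {l : Filter α}
    {A : α → RN N →L[ℝ] RN N} {B : RN N →L[ℝ] RN N}
    (h : ∀ v, Tendsto (fun a => A a v) l (𝓝 (B v))) : Tendsto A l (𝓝 B) := by
  have hsum : ∀ T : RN N →L[ℝ] RN N, T = ∑ i, (EuclideanSpace.proj i : RN N →L[ℝ] ℝ).smulRight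
      (T (EuclideanSpace.basisFun (Fin N) ℝ i)) := fun T => by
    ext1 v
    conv_lhs => rw [← (EuclideanSpace.basisFun (Fin N) ℝ).sum_repr v]
    simp [map_sum]
  rw [hsum B]
  refine Tendsto.congr (fun a => (hsum (A a)).symm) ?_
  exact tendsto_finsetSum _ fun i _ =>
    (ContinuousLinearMap.smulRightL ℝ (RN N) (RN N) (EuclideanSpace.proj i)).continuous.tendsto _
      |>.comp (h _)

section Lipschitz

variable {f : RN N → RN N} {k : NNReal}

theorem _root_.LipschitzWith.memLp_top_fderiv (hf : LipschitzWith k f) (μ : Measure (RN N)) :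
    MemLp (fderiv ℝ f) ∞ μ :=
  memLp_top_of_bound (measurable_fderiv ℝ f).aestronglyMeasurable k
    (.of_forall fun _ => norm_fderiv_le_of_lipschitz ℝ hf)

theorem integrable_smul_fderiv (hf : LipschitzWith k f) {μ : Measure (RN N)} {h : RN N → ℝ}
    (hh : Integrable h μ) : Integrable (fun x => h x • fderiv ℝ f x) μ :=
  hh.smul_of_top_left (hf.memLp_top_fderiv μ)

/-- Integration by parts for line derivatives of Lipschitz functions, applied in each coordinate; by
Rademacher's theorem the line derivative is almost everywhere given by `fderiv`. -/
theorem integral_fderiv_smul_eq (hf : LipschitzWith k f) {φ : RN N → ℝ} (hφ : ContDiff ℝ ∞ φ)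
    (hφs : HasCompactSupport φ) (v : RN N) :
    ∫ x, (fderiv ℝ φ x v) • f x = - ∫ x, φ x • fderiv ℝ f x v := by
  obtain ⟨D, hD⟩ := hφ.lipschitzWith_of_hasCompactSupport hφs (by simp)
  have hφi : Integrable φ := hφ.continuous.integrable_of_hasCompactSupport hφs
  have hi1 : Integrable (fun x => (fderiv ℝ φ x v) • f x) := by
    refine Continuous.integrable_of_hasCompactSupport ?_ ?_
    · exact ((hφ.continuous_fderiv (by simp)).clm_apply continuous_const).smul hf.continuous
    · exact (hφs.fderiv_apply ℝ v).smul_right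
  have hi2 : Integrable (fun x => φ x • fderiv ℝ f x v) :=
    (integrable_smul_fderiv hf hφi).apply_continuousLinearMap v
  ext i
  have hp := fun (g : RN N → RN N) (hg : Integrable g) =>
    ((EuclideanSpace.proj i : RN N →L[ℝ] ℝ).integral_comp_comm hg).symm
  have e1 := hp _ hi1
  have e2 := hp _ hi2
  simp only [PiLp.proj_apply, PiLp.smul_apply, smul_eq_mul] at e1 e2
  rw [PiLp.neg_apply, e1, e2]
  have hg : LipschitzWith k fun x => f x i :=
    LipschitzWith.of_dist_le_mul fun x y =>
      ((PiLp.dist_apply_le (f x) (f y) i).trans (hf.dist_le_mul x y))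
  have key := LipschitzWith.integral_lineDeriv_mul_eq (μ := volume) hg hD hφs v
  have h1 : ∫ x, lineDeriv ℝ (fun x => f x i) x v * φ x = ∫ x, φ x * fderiv ℝ f x v i := by
    refine integral_congr_ae ?_
    filter_upwards [hf.ae_differentiableAt] with x hx
    have h2 : HasFDerivAt (fun x => f x i)
        ((EuclideanSpace.proj i : RN N →L[ℝ] ℝ).comp (fderiv ℝ f x)) x :=
      (EuclideanSpace.proj i : RN N →L[ℝ] ℝ).hasFDerivAt.comp x hx.hasFDerivAt
    rw [(h2.hasLineDerivAt v).lineDeriv, mul_comm]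
    rfl
  have h2 : ∀ x, lineDeriv ℝ φ x (-v) = - fderiv ℝ φ x v := fun x => by
    rw [((hφ.differentiable (by simp)) x).lineDeriv_eq_fderiv, map_neg]
  rw [← h1, key, ← integral_neg]
  simp [h2]

theorem isW1InftyLoc_of_lipschitzWith (hf : LipschitzWith k f) : IsW1InftyLoc f (fderiv ℝ f) where
  isWeakGradient :=
    { locallyIntegrable := hf.continuous.locallyIntegrable
      locallyIntegrable_gradient := (hf.memLp_top_fderiv volume).locallyIntegrable le_top
      integral_eq := fun _ hφ hφs v => integral_fderiv_smul_eq hf hφ hφs v }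
  memLp K hK := by
    obtain ⟨M, hM⟩ := hK.exists_bound_of_continuousOn hf.continuous.continuousOn
    exact memLp_top_of_bound hf.continuous.aestronglyMeasurable M
      ((ae_restrict_iff' hK.measurableSet).2 (.of_forall hM))
  memLp_gradient K _ := hf.memLp_top_fderiv _

end Lipschitz

theorem weakStarTendstoLInftyLoc_of_tendstoLocallyUniformly {f : ℕ → RN N → RN N} {g : RN N → RN N}
    (hf : ∀ m, Continuous (f m)) (hg : Continuous g) (h : TendstoLocallyUniformly f g atTop) :
    WeakStarTendstoLInftyLoc f g := by
  intro K hK η hη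
  have hu := (tendstoLocallyUniformly_iff_forall_isCompact.1 h) K hK
  obtain ⟨M, hM⟩ := hK.exists_bound_of_continuousOn hg.continuousOn
  refine tendsto_integral_filter_of_dominated_convergence (fun x => ‖η x‖ * (M + 1))
    (.of_forall fun m => hη.aestronglyMeasurable.smul (hf m).aestronglyMeasurable) ?_
    (hη.norm.mul_const _) ?_
  · filter_upwards [Metric.tendstoUniformlyOn_iff.1 hu 1 one_pos] with m hm
    refine (ae_restrict_iff' hK.measurableSet).2 (.of_forall fun x hx => ?_)
    rw [norm_smul]
    gcongr
    have h1 := hm x hx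
    rw [dist_comm, dist_eq_norm] at h1
    have h2 := norm_add_le (f m x - g x) (g x)
    rw [sub_add_cancel] at h2
    linarith [hM x hx]
  · refine (ae_restrict_iff' hK.measurableSet).2 (.of_forall fun x hx => ?_)
    exact (hu.tendsto_at hx).const_smul (η x)

theorem tendsto_integral_smul_fderiv {f : ℕ → RN N → RN N} {g : RN N → RN N} {k : NNReal}
    (hf : ∀ m, LipschitzWith k (f m)) (hg : LipschitzWith k g)
    (h : TendstoLocallyUniformly f g atTop) {φ : RN N → ℝ} (hφ : ContDiff ℝ ∞ φ)
    (hφs : HasCompactSupport φ) :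
    Tendsto (fun m => ∫ x, φ x • fderiv ℝ (f m) x) atTop (𝓝 (∫ x, φ x • fderiv ℝ g x)) := by
  have hφi : Integrable φ := hφ.continuous.integrable_of_hasCompactSupport hφs
  refine tendsto_continuousLinearMap_of_forall_apply fun v => ?_
  have hform : ∀ u : RN N → RN N, LipschitzWith k u → (∫ x, φ x • fderiv ℝ u x) v =
      - ∫ x in tsupport φ, (fderiv ℝ φ x v) • u x := fun u hu => by
    rw [ContinuousLinearMap.integral_apply (integrable_smul_fderiv hu hφi),
      setIntegral_eq_integral_of_forall_compl_eq_zero, integral_fderiv_smul_eq hu hφ hφs, neg_neg]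
    · rfl
    · intro x hx
      rw [fderiv_of_notMem_tsupport ℝ hx]
      simp
  rw [hform g hg]
  simp_rw [fun m => hform (f m) (hf m)]
  refine (weakStarTendstoLInftyLoc_of_tendstoLocallyUniformly (fun m => (hf m).continuous)
    hg.continuous h _ hφs _ ?_).neg
  exact ((hφ.continuous_fderiv (by simp)).clm_apply continuous_const).continuousOn.integrableOn_compact
    hφs

/-- Against smooth compactly supported functions, integration by parts moves the derivative off the
maps. These functions are dense in `L^1` and the gradients are bounded by `k`, which gives all
integrable weights. -/
theorem weakStarTendstoW1InftyLoc_of_lipschitzWith {f : ℕ → RN N → RN N} {g : RN N → RN N}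
    {k : NNReal} (hf : ∀ m, LipschitzWith k (f m)) (hg : LipschitzWith k g)
    (h : TendstoLocallyUniformly f g atTop) : WeakStarTendstoW1InftyLoc f g := by
  refine ⟨fun m => fderiv ℝ (f m), fderiv ℝ g, fun m => isW1InftyLoc_of_lipschitzWith (hf m),
    isW1InftyLoc_of_lipschitzWith hg, weakStarTendstoLInftyLoc_of_tendstoLocallyUniformly
    (fun m => (hf m).continuous) hg.continuous h, ?_⟩
  intro K hK η hη
  have hH : Integrable (K.indicator η) := hη.integrable_indicator hK.measurableSet
  have hHeq : ∀ u : RN N → RN N, ∫ x in K, η x • fderiv ℝ u x =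
      ∫ x, K.indicator η x • fderiv ℝ u x := fun u => by
    rw [← integral_indicator hK.measurableSet]
    congr 1
    ext1 x
    by_cases hx : x ∈ K
    · simp only [indicator_of_mem hx]
    · simp only [indicator_of_notMem hx]
      exact (zero_smul ℝ (fderiv ℝ u x)).symm
  simp_rw [hHeq]
  refine Metric.tendsto_atTop.2 fun ε hε => ?_
  -- The `+ 1` covers `k = 0`.
  set ρ := ε / (3 * (k + 1)) with hρ
  have hρ0 : 0 < ρ := by positivity
  obtain ⟨φ, hφs, hφ, hφε⟩ := (memLp_one_iff_integrable.2 hH).exist_eLpNorm_sub_le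
    ENNReal.one_ne_top le_rfl hρ0
  have hφi : Integrable φ := hφ.continuous.integrable_of_hasCompactSupport hφs
  have hL1 : ∫ x, ‖K.indicator η x - φ x‖ ≤ ρ := by
    rw [eLpNorm_one_eq_lintegral_enorm] at hφε
    refine (integral_norm_eq_lintegral_enorm (hH.sub hφi).aestronglyMeasurable).trans_le ?_
    exact ENNReal.toReal_le_of_le_ofReal hρ0.le hφε
  have happ : ∀ u : RN N → RN N, LipschitzWith k u →
      dist (∫ x, K.indicator η x • fderiv ℝ u x) (∫ x, φ x • fderiv ℝ u x) ≤ ε / 3 := fun u hu => by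
    rw [dist_eq_norm, ← integral_sub (integrable_smul_fderiv hu hH) (integrable_smul_fderiv hu hφi)]
    calc ‖∫ x, (K.indicator η x • fderiv ℝ u x - φ x • fderiv ℝ u x)‖
        ≤ ∫ x, ‖K.indicator η x - φ x‖ * k := by
          refine norm_integral_le_of_norm_le ((hH.sub hφi).norm.mul_const _) (.of_forall fun x => ?_)
          have h1 := (sub_smul (K.indicator η x) (φ x) (fderiv ℝ u x)).symm
          refine (congrArg norm h1).trans_le ((norm_smul_le _ _).trans ?_)
          gcongr
          exact norm_fderiv_le_of_lipschitz ℝ hu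
      _ = (∫ x, ‖K.indicator η x - φ x‖) * k := integral_mul_const _ _
      _ ≤ ρ * (k + 1) := by gcongr; simp
      _ = ε / 3 := by rw [hρ]; field_simp
  obtain ⟨M, hM⟩ := Metric.tendsto_atTop.1 (tendsto_integral_smul_fderiv hf hg h hφ hφs) (ε / 3)
    (by positivity)
  refine ⟨M, fun m hm => ?_⟩
  have h1 := happ (f m) (hf m)
  have h2 := happ g hg
  have h3 := hM m hm
  rw [dist_comm] at h2
  have h4 := dist_triangle4 (∫ x, K.indicator η x • fderiv ℝ (f m) x)
    (∫ x, φ x • fderiv ℝ (f m) x) (∫ x, φ x • fderiv ℝ g x) (∫ x, K.indicator η x • fderiv ℝ g x)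
  linarith

end Folding

/-! ### The main theorem -/

theorem theorem2p1 (N : ℕ) (C : Set (EuclideanSpace ℝ (Fin N))) (hC : IsCompact C)
    (hconv : Convex ℝ C) (h0 : (0 : EuclideanSpace ℝ (Fin N)) ∈ interior C) :
    ∃ F : ℕ → EuclideanSpace ℝ (Fin N) → EuclideanSpace ℝ (Fin N),
      (∀ m, LocallyLipschitz (F m)) ∧
      -- (i)
      (∀ m, Folding.IsPiecewiseReflectionComposition (F m)) ∧
      (∀ m, ∀ᵐ u ∂(volume : Measure (EuclideanSpace ℝ (Fin N))),
        ∃ R : EuclideanSpace ℝ (Fin N) ≃ₗᵢ[ℝ] EuclideanSpace ℝ (Fin N),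
          HasFDerivAt (F m)
            (R.toContinuousLinearEquiv :
              EuclideanSpace ℝ (Fin N) →L[ℝ] EuclideanSpace ℝ (Fin N)) u) ∧
      -- (ii)
      (∀ m, EqOn (F m) id C) ∧
      (∀ m, ∀ A ⊆ C, F m '' A = A) ∧
      (∀ m : ℕ, 1 ≤ m → F m '' ((m : ℝ) • C) ⊆ (1 + 1 / (m : ℝ)) • C) ∧
      -- (iii)
      TendstoLocallyUniformly F (Folding.metricProjection C) atTop ∧
      Folding.WeakStarTendstoW1InftyLoc F (Folding.metricProjection C) := by
  have h0C := interior_subset h0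
  obtain ⟨r, hr, hball⟩ := Metric.nhds_basis_closedBall.mem_iff.1 (mem_interior_iff_mem_nhds.1 h0)
  obtain ⟨M, hM⟩ := hC.isBounded.exists_norm_le
  -- The radius covers `m • C` and, thanks to the `+ 1`, tends to infinity even if `M = 0`. In the
  -- error, `1` gives convergence to zero and `r` gives the inclusion in (ii).
  choose F hpw hlip hfix happ using fun m : ℕ =>
    Folding.exists_piecewise_approx_metricProjection hC hconv h0 (m * (M + 1))
      (ε := min r 1 / (m + 1)) (by positivity)
  have hM0 : 0 ≤ M := by simpa using hM 0 h0C
  have htend : TendstoLocallyUniformly F (Folding.metricProjection C) atTop := by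
    refine tendstoLocallyUniformly_iff_forall_isCompact.2 fun K hK => ?_
    refine Metric.tendstoUniformlyOn_iff.2 fun ε hε => ?_
    obtain ⟨R, hR⟩ := hK.isBounded.exists_norm_le
    have h1 : ∀ᶠ m : ℕ in atTop, R ≤ m :=
      tendsto_natCast_atTop_atTop.eventually (eventually_ge_atTop R)
    have h2 : ∀ᶠ m : ℕ in atTop, 1 / ((m : ℝ) + 1) < ε :=
      tendsto_one_div_add_atTop_nhds_zero_nat.eventually (gt_mem_nhds hε)
    filter_upwards [h1, h2] with m hm hm' u hu
    rw [dist_comm, dist_eq_norm]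
    refine (happ m u ?_).trans_lt (lt_of_le_of_lt ?_ hm')
    · refine (hR u hu).trans (hm.trans ?_)
      exact le_mul_of_one_le_right (by positivity) (by linarith)
    · gcongr
      exact min_le_right _ _
  refine ⟨F, fun m => (hlip m).locallyLipschitz, hpw, fun m => (hpw m).ae_hasFDerivAt,
    hfix, fun m A hA => ?_, fun m hm => ?_, htend,
    Folding.weakStarTendstoW1InftyLoc_of_lipschitzWith hlip
      (Folding.lipschitzWith_metricProjection hC ⟨0, h0C⟩ hconv) htend⟩
  · rw [(show EqOn (F m) id A from fun c hc => hfix m c (hA hc)).image_eq, image_id]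
  · rintro _ ⟨_, ⟨c, hc, rfl⟩, rfl⟩
    have hm0 : (0 : ℝ) < m := by exact_mod_cast hm
    have h1 := happ m ((m : ℝ) • c) (by
      rw [norm_smul, Real.norm_natCast]
      gcongr
      linarith [hM c hc])
    set u := (m : ℝ) • c
    have hp := (Folding.metricProjection_spec hC ⟨0, h0C⟩ u).1
    -- By convexity the target is `C + (1 / m) • C`: the projection lies in the first summand, and
    -- the error, of norm at most `r / m`, in the second.
    rw [hconv.add_smul zero_le_one (by positivity), one_smul]
    refine ⟨_, hp, F m u - Folding.metricProjection C u, ?_, add_sub_cancel _ _⟩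
    refine ⟨(m : ℝ) • (F m u - Folding.metricProjection C u), hball ?_, ?_⟩
    · rw [mem_closedBall_zero_iff, norm_smul, Real.norm_natCast]
      calc (m : ℝ) * ‖F m u - Folding.metricProjection C u‖ ≤ m * (min r 1 / (m + 1)) := by gcongr
        _ ≤ m * (r / m) := by
          gcongr
          · exact min_le_left _ _
          · linarith
        _ = r := mul_div_cancel₀ _ hm0.ne'
    · simp only [smul_smul]
      rw [one_div_mul_cancel hm0.ne', one_smul]
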